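/- Let $\mathcal M$ be a von Neumann algebra acting on a complex Hilbert space, let $\mathcal D\subseteq\mathcal M$ be a von Neumann subalgebra containing the unit of $\mathcal M$, and let $\omega$ be a normal state on $\mathcal M$ whose restriction to $\mathcal D$ is faithful ($d\in\mathcal D_+$ and $\omega(d)=0$ imply $d=0$) and tracial ($\omega(d^*d)=\omega(dd^*)$ for all $d\in\mathcal D$). Here a positive map is called normal if it preserves suprema of bounded increasing nets of positive elements. A normal conditional expectation from $\mathcal M$ onto $\mathcal D$ is a unital positive normal idempotent linear $\mathcal D$-bimodule map $E:\mathcal M\to\mathcal D$ with range $\mathcal D$; it is called $\omega$-preserving if $\omega\circ E=\omega$, and faithful if $x\in\mathcal M_+$ and $E(x)=0$ imply $x=0$. Then $$\omega(dx)=\omega(xd)\qquad\text{for all } d\in\mathcal D,\ x\in\mathcal M$$ if and only if there is an $\omega$-preserving normal conditional expectation from $\mathcal M$ onto $\mathcal D$. Moreover, there is at most one $\omega$-preserving normal conditional expectation from $\mathcal M$ onto $\mathcal D$, and if $\omega$ is faithful on $\mathcal M$, then any such expectation is faithful. -/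

import Mathlib

open scoped ComplexOrder

/-- A von Neumann algebra is closed under multiplication by complex scalars; this makes the type
`M` of its elements a complex vector space. -/
instance VonNeumannAlgebra.instSMulMemClass {H : Type*} [NormedAddCommGroup H]
    [InnerProductSpace ℂ H] [CompleteSpace H] :
    SMulMemClass (VonNeumannAlgebra H) ℂ (H →L[ℂ] H) where
  smul_mem {M} c _ hx := M.toStarSubalgebra.smul_mem hx c

/-- `f` maps positive elements to positive elements. On a von Neumann algebra `0 ≤ x` is the
operator (Loewner) order inherited from `H →L[ℂ] H`; on `ℂ` it says that `x` is real and
nonnegative. -/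
def IsPositiveMap {A B : Type*} [LE A] [Zero A] [LE B] [Zero B] (f : A → B) : Prop :=
  ∀ x : A, 0 ≤ x → 0 ≤ f x

/-- `f` preserves suprema of bounded increasing nets of positive elements. (The supremum of an
increasing net is that of its range, an upward directed nonempty set, which is the form used
here; boundedness is part of the existence of the supremum `s`.) -/
def IsNormalMap {A B : Type*} [Preorder A] [Zero A] [Preorder B] (f : A → B) : Prop :=
  ∀ S : Set A, S.Nonempty → DirectedOn (· ≤ ·) S → (∀ x ∈ S, 0 ≤ x) →
    ∀ s : A, IsLUB S s → IsLUB (f '' S) (f s)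

/-- `f` vanishes at no positive element other than `0`. -/
def IsFaithfulMap {A B : Type*} [LE A] [Zero A] [Zero B] (f : A → B) : Prop :=
  ∀ x : A, 0 ≤ x → f x = 0 → x = 0

namespace VonNeumannAlgebra

variable {H : Type*} [NormedAddCommGroup H] [InnerProductSpace ℂ H] [CompleteSpace H]

/-- A normal state on `M`: a positive, normal, complex linear functional taking `1` to `1`. -/
structure IsNormalState (M : VonNeumannAlgebra H) (ω : M →ₗ[ℂ] ℂ) : Prop where
  positive : IsPositiveMap ω
  map_one : ω 1 = 1
  normal : IsNormalMap ω

/-- The functional `φ` is tracial. -/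
def IsTracial (N : VonNeumannAlgebra H) (φ : N →ₗ[ℂ] ℂ) : Prop :=
  ∀ x : N, φ (star x * x) = φ (x * star x)

/-- The inclusion of a von Neumann subalgebra `D` (with the same unit) into `M`. -/
def incl {D M : VonNeumannAlgebra H} (h : D ≤ M) : D →ₗ[ℂ] M where
  toFun d := ⟨d, h d.2⟩
  map_add' _ _ := rfl
  map_smul' _ _ := rfl

/-- A normal conditional expectation from `M` onto the von Neumann subalgebra `D`: a unital,
positive, idempotent, normal `D`-bimodule map from `M` onto `D`. -/
structure IsNormalCondExp {D M : VonNeumannAlgebra H} (h : D ≤ M) (E : M →ₗ[ℂ] D) : Prop where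
  map_one : E 1 = 1
  positive : IsPositiveMap E
  idempotent : ∀ x : M, E (incl h (E x)) = E x
  surjective : Function.Surjective E
  map_mul_left : ∀ (d : D) (x : M), E (incl h d * x) = d * E x
  map_mul_right : ∀ (d : D) (x : M), E (x * incl h d) = E x * d
  normal : IsNormalMap E

/-- `E : M → D` preserves the functional `ω` on `M`, that is, `ω ∘ E = ω`. -/
def Preserves {D M : VonNeumannAlgebra H} (h : D ≤ M) (ω : M →ₗ[ℂ] ℂ) (E : M →ₗ[ℂ] D) : Prop :=
  ∀ x : M, ω (incl h (E x)) = ω x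

end VonNeumannAlgebra

/-! If `E` preserves `ω`, then ω(dx) = ω(E(dx)) = ω(d E(x)) = ω(E(x) d) = ω(xd), the middle equality
being traciality on `D`. Uniqueness holds because ω(E(x)d) = ω(xd) for all d determines E(x) when
`ω` is faithful on `D`. If E(x) = 0 then ω(x) = 0, so faithfulness passes from `ω` to `E`.

The substance is the existence of `E`. It is defined by ω(xd) = ω(E(x)d), so each x needs a density
in `D`; linearity, the bimodule property and positivity then follow from uniqueness of densities,
and normality from `isNormalMap_of_preserves`. The density (`exists_density_of_le_one`) is found
without completing to L². For 0 ≤ x ≤ 1 take the point h of the order interval [0,1] of `D` nearest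
to x in the two-norm Re ω(a⋆a)^{1/2}. The variational inequality at h, tested against an approximate
spectral projection of an approximate projection d of x - h to `D`, forces d to be small, so x - h
is orthogonal to `D`.

The nearest point exists because the interval is two-norm complete (`exists_limit_of_reForm_le`). As
`D` need not act on its GNS space, strong convergence on `H` is obtained from an Egorov-type
argument (`exists_monotone_cutoff`). -/

open Filter Topology

/-! ### Strong limits of bounded nets of operators. -/

section Operators

theorem ContinuousLinearMap.re_inner_le_of_le {H : Type*} [NormedAddCommGroup H]
    [InnerProductSpace ℂ H] {f g : H →L[ℂ] H} (h : f ≤ g) (v : H) :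
    (inner ℂ (f v) v).re ≤ (inner ℂ (g v) v).re := by
  have := ((le_def f g).1 h).re_inner_nonneg_left v
  simpa [inner_sub_left] using this

/-- A bounded family that converges at every vector converges strongly to a bounded operator. -/
theorem ContinuousLinearMap.exists_forall_tendsto_of_norm_le {H : Type*} [NormedAddCommGroup H]
    [InnerProductSpace ℂ H] {ι : Type*} {l : Filter ι} [l.NeBot]
    {f : ι → H →L[ℂ] H} {c : ℝ} (hc : ∀ i, ‖f i‖ ≤ c)
    (hlim : ∀ v, ∃ w, Tendsto (fun i => f i v) l (𝓝 w)) :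
    ∃ t : H →L[ℂ] H, ∀ v, Tendsto (fun i => f i v) l (𝓝 (t v)) := by
  choose T hT using hlim
  exact ⟨LinearMap.mkContinuous
    { toFun := T
      map_add' := fun v w => tendsto_nhds_unique (hT (v + w)) (by simpa using (hT v).add (hT w))
      map_smul' := fun r v => tendsto_nhds_unique (hT (r • v)) (by simpa using (hT v).const_smul r) }
    c fun v => le_of_tendsto (hT v).norm (Eventually.of_forall fun i =>
      (f i).le_of_opNorm_le (hc i) v), hT⟩

variable {H : Type*} [NormedAddCommGroup H] [InnerProductSpace ℂ H] [CompleteSpace H]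

theorem mul_self_le_norm_smul_of_nonneg {A : Type*} [CStarAlgebra A] [PartialOrder A]
    [StarOrderedRing A] {p : A} (hp : 0 ≤ p) : p * p ≤ ‖p‖ • p := by
  have h := CStarAlgebra.star_left_conjugate_le_norm_smul (a := CFC.sqrt p)
    (b := p) (IsSelfAdjoint.of_nonneg hp)
  have hs : star (CFC.sqrt p) = CFC.sqrt p := (IsSelfAdjoint.of_nonneg (CFC.sqrt_nonneg p)).star_eq
  have h2 : CFC.sqrt p * CFC.sqrt p = p := CFC.sqrt_mul_sqrt_self p hp
  rw [hs, h2] at h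
  generalize CFC.sqrt p = s at h h2
  refine le_trans (le_of_eq ?_) h
  rw [← h2]
  simp only [mul_assoc]

namespace ContinuousLinearMap

theorem norm_apply_sq_le_of_nonneg {p : H →L[ℂ] H} (hp : 0 ≤ p) (v : H) :
    ‖p v‖ ^ 2 ≤ ‖p‖ * (inner ℂ (p v) v).re := by
  have h := re_inner_le_of_le (mul_self_le_norm_smul_of_nonneg hp) v
  have hs : IsSelfAdjoint p := IsSelfAdjoint.of_nonneg hp
  have h1 : inner ℂ ((p * p) v) v = inner ℂ (p v) (p v) := by
    exact (isSelfAdjoint_iff_isSymmetric.1 hs) (p v) v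
  rw [h1] at h
  have h2 : (inner ℂ (p v) (p v)).re = ‖p v‖ ^ 2 := by
    rw [inner_self_eq_norm_sq_to_K]; norm_cast
  rw [h2] at h
  simpa [inner_smul_left] using h

theorem nonneg_of_forall_tendsto {ι : Type*} {l : Filter ι} [l.NeBot]
    {f : ι → H →L[ℂ] H} (h0 : ∀ᶠ i in l, 0 ≤ f i) {t : H →L[ℂ] H}
    (ht : ∀ v, Tendsto (fun i => f i v) l (𝓝 (t v))) : 0 ≤ t := by
  rw [nonneg_iff_isPositive, isPositive_def', isSelfAdjoint_iff_isSymmetric]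
  refine ⟨fun v w => ?_, fun v => ?_⟩
  · refine tendsto_nhds_unique ((ht v).inner (tendsto_const_nhds (x := w))) ?_
    refine ((tendsto_const_nhds (x := v)).inner (ht w)).congr' ?_
    filter_upwards [h0] with i hi
    exact ((isSelfAdjoint_iff_isSymmetric.1 (IsSelfAdjoint.of_nonneg hi)) v w).symm
  · refine ge_of_tendsto
      ((Complex.continuous_re.tendsto _).comp ((ht v).inner (tendsto_const_nhds (x := v)))) ?_
    filter_upwards [h0] with i hi
    exact ((nonneg_iff_isPositive _).1 hi).re_inner_nonneg_left v

theorem le_of_forall_tendsto {ι : Type*} {l : Filter ι} [l.NeBot]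
    {f : ι → H →L[ℂ] H} {t u : H →L[ℂ] H} (hu : ∀ᶠ i in l, f i ≤ u)
    (ht : ∀ v, Tendsto (fun i => f i v) l (𝓝 (t v))) : t ≤ u := by
  rw [← sub_nonneg]
  exact nonneg_of_forall_tendsto (f := fun i => u - f i) (hu.mono fun i hi => sub_nonneg.2 hi)
    fun v => by simpa using (tendsto_const_nhds (x := u v)).sub (ht v)

theorem ge_of_forall_tendsto {ι : Type*} {l : Filter ι} [l.NeBot]
    {f : ι → H →L[ℂ] H} {t u : H →L[ℂ] H} (hu : ∀ᶠ i in l, u ≤ f i)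
    (ht : ∀ v, Tendsto (fun i => f i v) l (𝓝 (t v))) : u ≤ t := by
  rw [← sub_nonneg]
  exact nonneg_of_forall_tendsto (f := fun i => f i - u) (hu.mono fun i hi => sub_nonneg.2 hi)
    fun v => by simpa using (ht v).sub (tendsto_const_nhds (x := u v))

/-- A bounded increasing net of positive operators converges strongly to its supremum. -/
theorem exists_isLUB_tendsto_of_monotone {ι : Type*} [Preorder ι] [Nonempty ι]
    [IsDirectedOrder ι] {f : ι → H →L[ℂ] H} (hf : Monotone f) (h0 : ∀ i, 0 ≤ f i)
    {b : H →L[ℂ] H} (hb : ∀ i, f i ≤ b) :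
    ∃ t : H →L[ℂ] H, IsLUB (Set.range f) t ∧ ∀ v, Tendsto (fun i => f i v) atTop (𝓝 (t v)) := by
  have hnb : ∀ i, ‖f i‖ ≤ ‖b‖ := fun i => CStarAlgebra.norm_le_norm_of_nonneg_of_le (h0 i) (hb i)
  -- The real numbers ⟨f i v, v⟩ increase and are bounded, hence converge; ‖p v‖² ≤ ‖p‖⟨p v, v⟩ for
  -- p = f i - f i₀ turns this into norm convergence of f i v.
  have hlim : ∀ v, ∃ w, Tendsto (fun i => f i v) atTop (𝓝 w) := by
    intro v
    have hr : Monotone fun i => (inner ℂ (f i v) v).re := fun i j hij => re_inner_le_of_le (hf hij) v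
    have hbd : BddAbove (Set.range fun i => (inner ℂ (f i v) v).re) :=
      ⟨(inner ℂ (b v) v).re, by rintro _ ⟨i, rfl⟩; exact re_inner_le_of_le (hb i) v⟩
    have ht := tendsto_atTop_ciSup hr hbd
    set L := ⨆ i, (inner ℂ (f i v) v).re
    have hle : ∀ i, (inner ℂ (f i v) v).re ≤ L := fun i => le_ciSup hbd i
    apply cauchy_map_iff_exists_tendsto.1
    rw [Metric.cauchy_iff]
    refine ⟨inferInstance, fun ε hε => ?_⟩
    have hδ : 0 < (ε / 2) ^ 2 / (‖b‖ + 1) := by positivity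
    obtain ⟨i₀, hi₀⟩ := (ht.eventually (lt_mem_nhds (show L - (ε / 2) ^ 2 / (‖b‖ + 1) < L by
      linarith))).exists
    have key : ∀ i, i₀ ≤ i → ‖f i v - f i₀ v‖ < ε / 2 := by
      intro i hi
      have hp : 0 ≤ f i - f i₀ := sub_nonneg.2 (hf hi)
      have h1 := norm_apply_sq_le_of_nonneg hp v
      have h2 : ‖f i - f i₀‖ ≤ ‖b‖ :=
        CStarAlgebra.norm_le_norm_of_nonneg_of_le hp ((sub_le_self _ (h0 i₀)).trans (hb i))
      have h3 : (inner ℂ ((f i - f i₀) v) v).re < (ε / 2) ^ 2 / (‖b‖ + 1) := by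
        have := hle i
        simp only [sub_apply, inner_sub_left, Complex.sub_re]
        linarith
      have h4 : 0 ≤ (inner ℂ ((f i - f i₀) v) v).re := by
        have := re_inner_le_of_le hp v
        simpa using this
      have h5 : ‖(f i - f i₀) v‖ ^ 2 < (ε / 2) ^ 2 := by
        calc _ ≤ _ := h1
          _ ≤ ‖b‖ * (inner ℂ ((f i - f i₀) v) v).re := by gcongr
          _ ≤ (‖b‖ + 1) * (inner ℂ ((f i - f i₀) v) v).re := by linarith
          _ < (‖b‖ + 1) * ((ε / 2) ^ 2 / (‖b‖ + 1)) := by gcongr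
          _ = _ := by field_simp
      exact lt_of_pow_lt_pow_left₀ 2 (by positivity) h5
    refine ⟨(fun i => f i v) '' Set.Ici i₀, image_mem_map (Ici_mem_atTop i₀), ?_⟩
    rintro _ ⟨i, hi, rfl⟩ _ ⟨j, hj, rfl⟩
    calc dist (f i v) (f j v) ≤ dist (f i v) (f i₀ v) + dist (f j v) (f i₀ v) :=
          dist_triangle_right _ _ _
      _ < ε / 2 + ε / 2 := by
          rw [dist_eq_norm, dist_eq_norm]; exact add_lt_add (key i hi) (key j hj)
      _ = ε := by ring
  obtain ⟨t, ht⟩ := exists_forall_tendsto_of_norm_le hnb hlim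
  refine ⟨t, ⟨?_, ?_⟩, ht⟩
  · rintro _ ⟨i, rfl⟩
    exact ge_of_forall_tendsto (by filter_upwards [Ici_mem_atTop i] with j hj using hf hj) ht
  · exact fun u hu => le_of_forall_tendsto (Eventually.of_forall fun i => hu ⟨i, rfl⟩) ht

end ContinuousLinearMap

namespace VonNeumannAlgebra

variable {D : VonNeumannAlgebra H}

/-- The double commutant theorem in the form used to keep functional calculus, inverses and strong
limits inside `D`. -/
theorem mem_of_forall_commute {a : H →L[ℂ] H} (h : ∀ b ∈ D.commutant, Commute a b) : a ∈ D := by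
  rw [← commutant_commutant D, mem_commutant_iff]
  exact fun b hb => (h b hb).symm.eq

theorem commute_of_mem_commutant {a b : H →L[ℂ] H} (ha : a ∈ D) (hb : b ∈ D.commutant) :
    Commute a b :=
  mem_commutant_iff.1 hb a ha

theorem cfc_mem {a : H →L[ℂ] H} (ha : a ∈ D) (f : ℝ → ℝ) : cfc f a ∈ D :=
  mem_of_forall_commute fun _ hb => (commute_of_mem_commutant ha hb).cfc_real f

theorem mem_of_tendsto {ι : Type*} {l : Filter ι} [l.NeBot] {f : ι → H →L[ℂ] H}
    (hf : ∀ i, f i ∈ D) {t : H →L[ℂ] H} (ht : ∀ v, Tendsto (fun i => f i v) l (𝓝 (t v))) :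
    t ∈ D := by
  refine mem_of_forall_commute fun b hb => ?_
  ext v
  refine tendsto_nhds_unique (ht (b v)) ?_
  refine ((b.continuous.tendsto _).comp (ht v)).congr fun i => ?_
  exact congr($((commute_of_mem_commutant (hf i) hb).eq.symm) v)

theorem smul_mem_real {a : H →L[ℂ] H} (ha : a ∈ D) (r : ℝ) : r • a ∈ D := by
  rw [← Complex.coe_smul]; exact SMulMemClass.smul_mem _ ha

end VonNeumannAlgebra

end Operators

/-! ### Projections and nearest points for a positive semidefinite form. -/

section BilinearForms

variable {V : Type*} [AddCommGroup V] [Module ℝ V] {B : LinearMap.BilinForm ℝ V}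

/-- Almost orthogonal projection onto a subspace for a positive semidefinite form. -/
theorem LinearMap.BilinForm.exists_mem_abs_apply_sub_le (hs : ∀ u v, B u v = B v u)
    (hp : ∀ v, 0 ≤ B v v) (W : Submodule ℝ V) (y : V) {ε : ℝ} (hε : 0 < ε) :
    ∃ d ∈ W, ∀ k ∈ W, |B (y - d) k| ≤ ε * √(B k k) := by
  let I := ⨅ d : W, B (y - d) (y - d)
  have hbd : BddBelow (Set.range fun d : W => B (y - d) (y - d)) :=
    ⟨0, by rintro _ ⟨d, rfl⟩; exact hp _⟩
  obtain ⟨d, hd⟩ := exists_lt_of_ciInf_lt (show I < I + ε ^ 2 by have := pow_pos hε 2; linarith)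
  refine ⟨d, d.2, fun k hk => ?_⟩
  -- d is within ε² of the infimum, and d - t k is a competitor. The discriminant of this quadratic
  -- in t gives the bound.
  have key : ∀ t : ℝ, 0 ≤ B k k * (t * t) + (2 * B (y - d) k) * t + ε ^ 2 := by
    intro t
    have h1 : I ≤ B (y - (d - t • k)) (y - (d - t • k)) :=
      ciInf_le hbd (⟨d - t • k, W.sub_mem d.2 (W.smul_mem t hk)⟩ : W)
    have h2 : y - ((d : V) - t • k) = (y - d) + t • k := by abel
    rw [h2] at h1
    simp only [map_add, LinearMap.add_apply, map_smul, LinearMap.smul_apply, smul_eq_mul] at h1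
    rw [hs k (y - d)] at h1
    linarith
  have h := discrim_le_zero key
  rw [discrim] at h
  refine abs_le_of_sq_le_sq ?_ ?_
  · rw [mul_pow, Real.sq_sqrt (hp k)]; linarith
  · positivity

/-- A point of a convex set nearest to a given one exists if the set is sequentially complete. -/
theorem LinearMap.BilinForm.exists_mem_forall_apply_sub_sub_nonpos (hs : ∀ u v, B u v = B v u)
    (hp : ∀ v, 0 ≤ B v v) {S : Set V} (hne : S.Nonempty) (hconv : Convex ℝ S)
    (hcomp : ∀ u : ℕ → V, (∀ n, u n ∈ S) →
      (∀ n, B (u n - u (n + 1)) (u n - u (n + 1)) ≤ (1 / 16) ^ n) →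
      ∃ h ∈ S, Tendsto (fun n => B (u n - h) (u n - h)) atTop (𝓝 0)) (x : V) :
    ∃ h ∈ S, ∀ k ∈ S, B (x - h) (k - h) ≤ 0 := by
  have hcs : ∀ u v, B u v ^ 2 ≤ B u u * B v v := fun u v => by
    have := B.apply_mul_apply_le_of_forall_zero_le hp u v
    rwa [hs v u, ← sq] at this
  have : Nonempty S := hne.to_subtype
  let I := ⨅ d : S, B (x - d) (x - d)
  have hbd : BddBelow (Set.range fun d : S => B (x - d) (x - d)) :=
    ⟨0, by rintro _ ⟨d, rfl⟩; exact hp _⟩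
  have hI : ∀ d ∈ S, I ≤ B (x - d) (x - d) := fun d hd => ciInf_le hbd (⟨d, hd⟩ : S)
  have hex : ∀ n : ℕ, ∃ d : S, B (x - d) (x - d) < I + (1 / 16) ^ n / 4 := fun n =>
    exists_lt_of_ciInf_lt (show I < I + (1 / 16) ^ n / 4 by
      have : (0 : ℝ) < (1 / 16) ^ n := by positivity
      linarith)
  choose u hu using hex
  -- Parallelogram law: the midpoint lies in `S`, so its squared distance to x is at least `I`,
  -- while those of its endpoints exceed `I` by less than (1/16)^n / 4.
  have hcau : ∀ n, B (u n - u (n + 1)) ((u n : V) - u (n + 1)) ≤ (1 / 16) ^ n := by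
    intro n
    have hm : (1 / 2 : ℝ) • (u n : V) + (1 / 2 : ℝ) • (u (n + 1) : V) ∈ S :=
      hconv (u n).2 (u (n + 1)).2 (by norm_num) (by norm_num) (by norm_num)
    have h1 := hI _ hm
    have h2 : x - ((1 / 2 : ℝ) • (u n : V) + (1 / 2 : ℝ) • (u (n + 1) : V))
        = (1 / 2 : ℝ) • ((x - u n) + (x - u (n + 1))) := by module
    have h3 : (u n : V) - u (n + 1) = (x - u (n + 1)) - (x - u n) := by abel
    rw [h2] at h1
    rw [h3]
    have ha := hu n
    have hb := hu (n + 1)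
    generalize x - (u n : V) = a at *
    generalize x - (u (n + 1) : V) = b at *
    simp only [map_add, LinearMap.add_apply, map_smul, LinearMap.smul_apply, smul_eq_mul, map_sub,
      LinearMap.sub_apply] at h1 ⊢
    rw [hs b a] at h1 ⊢
    have : (1 / 16 : ℝ) ^ (n + 1) ≤ (1 / 16) ^ n := by
      rw [pow_succ]; have : (0 : ℝ) < (1 / 16) ^ n := by positivity
      linarith
    linarith
  obtain ⟨h, hh, hlim⟩ := hcomp (fun n => u n) (fun n => (u n).2) hcau
  refine ⟨h, hh, fun k hk => ?_⟩
  have hmin : B (x - h) (x - h) ≤ I := by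
    have hbound : ∀ n : ℕ, B (x - h) (x - h) ≤
        I + (1 / 16) ^ n / 4 + 2 * √((I + 1) * B (u n - h) (u n - h)) + B (u n - h) (u n - h) := by
      intro n
      have e : x - h = (x - u n) + (u n - h) := by abel
      have h1 := hcs (x - u n) (u n - h)
      have h2 := hu n
      rw [e]
      have h3 := hp ((u n : V) - h)
      have h4 : B (x - u n) (u n - h) ≤ √((I + 1) * B (u n - h) (u n - h)) := by
        apply Real.le_sqrt_of_sq_le
        refine h1.trans (mul_le_mul_of_nonneg_right ?_ h3)
        have : (1 / 16 : ℝ) ^ n ≤ 1 := pow_le_one₀ (by norm_num) (by norm_num)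
        linarith
      generalize (u n : V) - h = b at *
      simp only [map_add, LinearMap.add_apply]
      rw [hs b]
      linarith
    have ht : Tendsto (fun n : ℕ => I + (1 / 16 : ℝ) ^ n / 4
        + 2 * √((I + 1) * B (u n - h) (u n - h)) + B (u n - h) (u n - h)) atTop
        (𝓝 (I + 0 / 4 + 2 * √((I + 1) * 0) + 0)) := by
      refine Tendsto.add (Tendsto.add (tendsto_const_nhds.add (Tendsto.div_const ?_ _))
        (Tendsto.const_mul _ ?_)) hlim
      · exact tendsto_pow_atTop_nhds_zero_of_lt_one (by norm_num) (by norm_num)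
      · exact (Real.continuous_sqrt.tendsto _).comp (hlim.const_mul _)
    have := ge_of_tendsto' ht hbound
    simpa using this
  by_contra! hpos
  have key : ∀ t : ℝ, 0 ≤ t → t ≤ 1 →
      2 * t * B (x - h) (k - h) ≤ t ^ 2 * B (k - h) (k - h) := by
    intro t ht0 ht1
    have hm : (1 - t) • h + t • k ∈ S := hconv hh hk (by linarith) ht0 (by ring)
    have h1 := hmin.trans (hI _ hm)
    have e : x - ((1 - t) • h + t • k) = (x - h) - t • (k - h) := by module
    rw [e] at h1
    generalize x - h = a at *
    generalize k - h = b at *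
    simp only [LinearMap.sub_apply, map_smul, LinearMap.smul_apply, smul_eq_mul, map_sub] at h1
    rw [hs b a] at h1
    nlinarith
  set b := B (x - h) (k - h)
  set c := B (k - h) (k - h) with hc
  have hc0 : 0 ≤ c := hp _
  have hden : 0 < b + c := by linarith
  -- This t lies in (0, 1] and satisfies t c ≤ b, whereas `key` yields 2 b ≤ t c.
  have h1 := key (b / (b + c)) (by positivity) ((div_le_one hden).2 (by linarith))
  have h2 : 0 < b / (b + c) := by positivity
  have h3 : 2 * b ≤ b / (b + c) * c := by
    have : b / (b + c) * (2 * b) ≤ b / (b + c) * (b / (b + c) * c) := by nlinarith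
    exact le_of_mul_le_mul_left this h2
  have h4 : b / (b + c) * c ≤ b := by
    rw [div_mul_eq_mul_div, div_le_iff₀ hden]; nlinarith
  linarith

end BilinearForms

/-! ### The two-norm form of a positive functional. -/

section Functionals

variable {H : Type*} [NormedAddCommGroup H] [InnerProductSpace ℂ H] [CompleteSpace H]

namespace VonNeumannAlgebra

/-- The functional `τ` on all bounded operators is nonnegative on the positive elements of `M`. -/
def IsPositiveOn (M : VonNeumannAlgebra H) (τ : (H →L[ℂ] H) →ₗ[ℂ] ℂ) : Prop :=
  ∀ a ∈ M, 0 ≤ a → 0 ≤ τ a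

/-- The real part of the sesquilinear form `τ (a⋆ b)`. -/
noncomputable def reForm (τ : (H →L[ℂ] H) →ₗ[ℂ] ℂ) : LinearMap.BilinForm ℝ (H →L[ℂ] H) :=
  LinearMap.mk₂ ℝ (fun a b => (τ (star a * b)).re)
    (fun a b c => by simp [add_mul]) (fun r a b => by simp [← Complex.coe_smul])
    (fun a b c => by simp [mul_add]) (fun r a b => by simp [← Complex.coe_smul])

theorem reForm_apply (τ : (H →L[ℂ] H) →ₗ[ℂ] ℂ) (a b : H →L[ℂ] H) :
    reForm τ a b = (τ (star a * b)).re := rfl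

namespace IsPositiveOn

variable {M : VonNeumannAlgebra H} {τ : (H →L[ℂ] H) →ₗ[ℂ] ℂ}

theorem re_nonneg (hτ : M.IsPositiveOn τ) {a : H →L[ℂ] H} (ha : a ∈ M) (h : 0 ≤ a) :
    0 ≤ (τ a).re := (Complex.le_def.1 (hτ a ha h)).1

theorem re_mono (hτ : M.IsPositiveOn τ) {a b : H →L[ℂ] H} (ha : a ∈ M) (hb : b ∈ M) (h : a ≤ b) :
    (τ a).re ≤ (τ b).re := by
  have := hτ.re_nonneg (sub_mem hb ha) (sub_nonneg.2 h)
  simpa using this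

theorem im_eq_zero (hτ : M.IsPositiveOn τ) {a : H →L[ℂ] H} (ha : a ∈ M) (h : IsSelfAdjoint a) :
    (τ a).im = 0 := by
  have h1 : 0 ≤ a + ‖a‖ • (1 : H →L[ℂ] H) := by
    have := h.neg_algebraMap_norm_le_self
    rw [Algebra.algebraMap_eq_smul_one] at this
    simpa using add_le_add_left this (‖a‖ • (1 : H →L[ℂ] H))
  have h2 : (0 : H →L[ℂ] H) ≤ ‖a‖ • (1 : H →L[ℂ] H) := smul_nonneg (norm_nonneg _) zero_le_one
  have m2 : ‖a‖ • (1 : H →L[ℂ] H) ∈ M := smul_mem_real (one_mem M) _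
  have e1 := (Complex.le_def.1 (hτ _ (add_mem ha m2) h1)).2
  have e2 := (Complex.le_def.1 (hτ _ m2 h2)).2
  simp only [map_add, Complex.add_im, Complex.zero_im] at e1 e2
  linarith

theorem map_star (hτ : M.IsPositiveOn τ) {a : H →L[ℂ] H} (ha : a ∈ M) :
    τ (star a) = star (τ a) := by
  have h1 := hτ.im_eq_zero (add_mem ha (star_mem ha)) (IsSelfAdjoint.add_star_self a)
  have h2 := hτ.im_eq_zero (a := Complex.I • (a - star a))
    (SMulMemClass.smul_mem _ (sub_mem ha (star_mem ha))) (by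
      rw [IsSelfAdjoint, star_smul, star_sub, star_star]
      simp only [Complex.star_def, Complex.conj_I, neg_smul, smul_sub]
      abel)
  simp only [map_add, map_smul, map_sub, Complex.add_im, smul_eq_mul, Complex.mul_im, Complex.I_re,
    Complex.I_im, Complex.sub_re] at h1 h2
  apply Complex.ext <;> simp <;> linarith

theorem reForm_self_nonneg (hτ : M.IsPositiveOn τ) {a : H →L[ℂ] H} (ha : a ∈ M) :
    0 ≤ reForm τ a a :=
  hτ.re_nonneg (mul_mem (star_mem ha) ha) (star_mul_self_nonneg a)

theorem reForm_comm (hτ : M.IsPositiveOn τ) {a b : H →L[ℂ] H} (ha : a ∈ M) (hb : b ∈ M) :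
    reForm τ a b = reForm τ b a := by
  have := hτ.map_star (mul_mem (star_mem ha) hb)
  rw [star_mul, star_star] at this
  rw [reForm_apply, reForm_apply, this]
  simp

theorem reForm_sq_le (hτ : M.IsPositiveOn τ) {a b : H →L[ℂ] H} (ha : a ∈ M) (hb : b ∈ M) :
    reForm τ a b ^ 2 ≤ reForm τ a a * reForm τ b b := by
  have h := LinearMap.BilinForm.apply_mul_apply_le_of_forall_zero_le
    ((reForm τ).restrict (M.toStarSubalgebra.toSubalgebra.toSubmodule.restrictScalars ℝ))
    (fun x => hτ.reForm_self_nonneg x.2) ⟨a, ha⟩ ⟨b, hb⟩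
  have h' : reForm τ a b * reForm τ b a ≤ reForm τ a a * reForm τ b b := h
  rwa [hτ.reForm_comm hb ha, ← sq] at h'

theorem reForm_self_le (hτ : M.IsPositiveOn τ) (h1 : τ 1 = 1) {a : H →L[ℂ] H} (ha : a ∈ M) :
    reForm τ a a ≤ ‖a‖ ^ 2 := by
  have h := CStarAlgebra.star_mul_le_algebraMap_norm_sq (a := a)
  rw [Algebra.algebraMap_eq_smul_one] at h
  have := hτ.re_mono (mul_mem (star_mem ha) ha) (smul_mem_real (one_mem M) _) h
  rw [← Complex.coe_smul, map_smul, h1] at this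
  simpa [reForm_apply, ← Complex.ofReal_pow] using this

end IsPositiveOn

end VonNeumannAlgebra

end Functionals

/-! ### Two-norm completeness of the unit interval of `D`. -/

section TwoNorm

variable {H : Type*} [NormedAddCommGroup H] [InnerProductSpace ℂ H] [CompleteSpace H]

open ContinuousLinearMap

namespace VonNeumannAlgebra

/-- `τ` preserves suprema of bounded upward directed sets of positive elements of `M`. -/
def IsNormalOn (M : VonNeumannAlgebra H) (τ : (H →L[ℂ] H) →ₗ[ℂ] ℂ) : Prop :=
  ∀ S : Set (H →L[ℂ] H), S ⊆ M → S.Nonempty → DirectedOn (· ≤ ·) S → (∀ x ∈ S, 0 ≤ x) →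
    ∀ s ∈ M, IsLUB S s → IsLUB (τ '' S) (τ s)

theorem IsNormalOn.isLUB_re {M : VonNeumannAlgebra H} {τ : (H →L[ℂ] H) →ₗ[ℂ] ℂ}
    (hn : M.IsNormalOn τ) (hτ : M.IsPositiveOn τ) {S : Set (H →L[ℂ] H)} (hS : S ⊆ M)
    (hne : S.Nonempty) (hd : DirectedOn (· ≤ ·) S) (h0 : ∀ x ∈ S, 0 ≤ x) {s : H →L[ℂ] H}
    (hs : s ∈ M) (hlub : IsLUB S s) : IsLUB ((fun a => (τ a).re) '' S) (τ s).re := by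
  have h := hn S hS hne hd h0 s hs hlub
  refine ⟨?_, fun r hr => ?_⟩
  · rintro _ ⟨a, ha, rfl⟩
    exact hτ.re_mono (hS ha) hs (hlub.1 ha)
  · have : τ s ≤ (r : ℂ) := by
      refine h.2 ?_
      rintro _ ⟨a, ha, rfl⟩
      refine Complex.le_def.2 ⟨hr ⟨a, ha, rfl⟩, ?_⟩
      simpa using hτ.im_eq_zero (hS ha) (IsSelfAdjoint.of_nonneg (h0 a ha))
    exact (Complex.le_def.1 this).1

theorem exists_strong_limit_of_monotone {D : VonNeumannAlgebra H} {τ : (H →L[ℂ] H) →ₗ[ℂ] ℂ}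
    (hτ : D.IsPositiveOn τ) (hn : D.IsNormalOn τ) {f : ℕ → H →L[ℂ] H} (hf : Monotone f)
    (hfD : ∀ n, f n ∈ D) (h0 : ∀ n, 0 ≤ f n) (h1 : ∀ n, f n ≤ 1) :
    ∃ t ∈ D, 0 ≤ t ∧ t ≤ 1 ∧ IsLUB (Set.range f) t ∧
      (∀ v, Tendsto (fun n => f n v) atTop (𝓝 (t v))) ∧
      Tendsto (fun n => (τ (f n)).re) atTop (𝓝 (τ t).re) := by
  obtain ⟨t, hlub, ht⟩ := exists_isLUB_tendsto_of_monotone hf h0 h1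
  have htD := mem_of_tendsto hfD ht
  refine ⟨t, htD, (h0 0).trans (hlub.1 ⟨0, rfl⟩), hlub.2 (by rintro _ ⟨n, rfl⟩; exact h1 n),
    hlub, ht, ?_⟩
  have h := hn.isLUB_re hτ (S := Set.range f) (by rintro _ ⟨n, rfl⟩; exact hfD n)
    (Set.range_nonempty f) (directedOn_range.2 hf.directed_le)
    (by rintro _ ⟨n, rfl⟩; exact h0 n) htD hlub
  rw [← Set.range_comp] at h
  exact tendsto_atTop_isLUB (fun i j hij => hτ.re_mono (hfD i) (hfD j) (hf hij)) h

theorem ringInverse_mem {D : VonNeumannAlgebra H} {a : H →L[ℂ] H} (ha : a ∈ D) :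
    Ring.inverse a ∈ D :=
  mem_of_forall_commute fun b hb => by
    have h : Commute a b := commute_of_mem_commutant ha hb
    by_cases hu : IsUnit a
    · obtain ⟨u, rfl⟩ := hu
      rw [Ring.inverse_unit]
      exact h.units_inv_left
    · rw [Ring.inverse_non_unit _ hu]
      exact Commute.zero_left b

section Resolvent

variable {A : Type*} [CStarAlgebra A] [PartialOrder A] [StarOrderedRing A] {s : A}

theorem isUnit_one_add_of_nonneg (hs : 0 ≤ s) : IsUnit (1 + s) :=
  CStarAlgebra.isUnit_of_le 1 (le_add_of_nonneg_right hs)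

theorem ringInverse_one_add_nonneg (hs : 0 ≤ s) : 0 ≤ Ring.inverse (1 + s) := by
  obtain ⟨u, hu⟩ := isUnit_one_add_of_nonneg hs
  rw [← hu, Ring.inverse_unit]
  exact CFC.inv_nonneg_of_nonneg u (by rw [hu]; exact add_nonneg zero_le_one hs)

theorem ringInverse_one_add_le_one (hs : 0 ≤ s) : Ring.inverse (1 + s) ≤ 1 := by
  obtain ⟨u, hu⟩ := isUnit_one_add_of_nonneg hs
  rw [← hu, Ring.inverse_unit]
  exact CStarAlgebra.inv_le_one (Units.val_le_val.1 (by
    rw [Units.val_one, hu]; exact le_add_of_nonneg_right hs))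

theorem one_sub_ringInverse_one_add_le (hs : 0 ≤ s) : 1 - Ring.inverse (1 + s) ≤ s := by
  have h1 := Ring.mul_inverse_cancel _ (isUnit_one_add_of_nonneg hs)
  have h2 := Ring.inverse_mul_cancel _ (isUnit_one_add_of_nonneg hs)
  have h0 := ringInverse_one_add_nonneg hs
  generalize Ring.inverse (1 + s) = g at *
  have h := star_left_conjugate_nonneg h0 s
  rw [(IsSelfAdjoint.of_nonneg hs).star_eq] at h
  have e1 : s * g = 1 - g := by rw [add_mul, one_mul] at h1; rw [← h1]; abel
  have e2 : g * s = 1 - g := by rw [mul_add, mul_one] at h2; rw [← h2]; abel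
  rw [e1, sub_mul, one_mul, e2] at h
  exact sub_nonneg.1 h

theorem ringInverse_one_add_anti {s' : A} (hs : 0 ≤ s) (h : s ≤ s') :
    Ring.inverse (1 + s') ≤ Ring.inverse (1 + s) := by
  obtain ⟨u, hu⟩ := isUnit_one_add_of_nonneg hs
  obtain ⟨u', hu'⟩ := isUnit_one_add_of_nonneg (hs.trans h)
  rw [← hu, ← hu', Ring.inverse_unit, Ring.inverse_unit]
  exact CStarAlgebra.inv_le_inv (by rw [hu]; exact add_nonneg zero_le_one hs) (by rw [hu, hu']; gcongr)

end Resolvent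

/-- With w = (1 + s)⁻¹ v one has c²‖a w‖² ≤ ⟨(1 + s) w, w⟩ = ⟨v, w⟩ ≤ ‖v‖². No commutation of a with
s is needed. -/
theorem norm_apply_ringInverse_one_add_le {a s : H →L[ℂ] H} (ha : IsSelfAdjoint a) (hs : 0 ≤ s)
    {c : ℝ} (h : c ^ 2 • (a * a) ≤ s) (v : H) :
    |c| * ‖a (Ring.inverse (1 + s) v)‖ ≤ ‖v‖ := by
  set g := Ring.inverse (1 + s) with hg
  have h1 : (1 + s) (g v) = v := by
    have := Ring.mul_inverse_cancel _ (isUnit_one_add_of_nonneg hs)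
    exact congr($this v)
  have h2 := re_inner_le_of_le (h.trans (le_add_of_nonneg_left zero_le_one)) (g v)
  rw [h1] at h2
  have h3 : inner ℂ ((c ^ 2 • (a * a)) (g v)) (g v) = ((c ^ 2 * ‖a (g v)‖ ^ 2 : ℝ) : ℂ) := by
    have e : inner ℂ (a (a (g v))) (g v) = inner ℂ (a (g v)) (a (g v)) :=
      (isSelfAdjoint_iff_isSymmetric.1 ha) _ _
    change inner ℂ (c ^ 2 • a (a (g v))) (g v) = _
    rw [inner_smul_left_eq_smul, e, inner_self_eq_norm_sq_to_K]
    simp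
  rw [h3, Complex.ofReal_re] at h2
  have hgn : ‖g‖ ≤ 1 :=
    (CStarAlgebra.norm_le_one_iff_of_nonneg _ (ringInverse_one_add_nonneg hs)).2
      (ringInverse_one_add_le_one hs)
  have h4 : (inner ℂ v (g v)).re ≤ ‖v‖ ^ 2 := by
    calc (inner ℂ v (g v)).re ≤ ‖inner ℂ v (g v)‖ := Complex.re_le_norm _
      _ ≤ ‖v‖ * ‖g v‖ := norm_inner_le_norm _ _
      _ ≤ ‖v‖ * (1 * ‖v‖) := by gcongr; exact g.le_of_opNorm_le hgn v
      _ = _ := by ring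
  refine le_of_sq_le_sq ?_ (norm_nonneg v)
  rw [mul_pow, sq_abs]
  linarith

/-- Off sets of small trace, a sequence that is fast Cauchy in the two-norm is uniformly Cauchy:
the role of the indicator functions is played by the increasing sequence `G`. -/
theorem exists_monotone_cutoff {D : VonNeumannAlgebra H} {τ : (H →L[ℂ] H) →ₗ[ℂ] ℂ}
    (hτ : D.IsPositiveOn τ) (hn : D.IsNormalOn τ)
    (hf : ∀ a ∈ D, 0 ≤ a → τ a = 0 → a = 0) {a : ℕ → H →L[ℂ] H} (haD : ∀ n, a n ∈ D)
    (ha : ∀ n, IsSelfAdjoint (a n)) (hsmall : ∀ n, reForm τ (a n) (a n) ≤ (1 / 16) ^ n) :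
    ∃ G : ℕ → H →L[ℂ] H, (∀ N, G N ∈ D) ∧ (∀ N, 0 ≤ G N) ∧ (∀ N, G N ≤ 1) ∧
      (∀ N, (τ (1 - G N)).re ≤ 2 * (1 / 4) ^ N) ∧
      (∀ v, Tendsto (fun N => G N v) atTop (𝓝 v)) ∧
      ∀ N k, N ≤ k → ∀ v, ‖a k (G N v)‖ ≤ (1 / 2) ^ k * ‖v‖ := by
  -- The weight 4^k leaves τ(b k) ≤ 4^{-k}, still summable, while b k ≤ s gives ‖a k (1 + s)⁻¹‖ ≤
  -- 2^{-k}.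
  let b : ℕ → H →L[ℂ] H := fun k => ((2 : ℝ) ^ k) ^ 2 • (a k * a k)
  have hb0 : ∀ k, 0 ≤ b k := fun k => by
    refine smul_nonneg (by positivity) ?_
    have := star_mul_self_nonneg (a k)
    rwa [(ha k).star_eq] at this
  have hbD : ∀ k, b k ∈ D := fun k => smul_mem_real (mul_mem (haD k) (haD k)) _
  have hbτ : ∀ k, (τ (b k)).re ≤ (1 / 4) ^ k := by
    intro k
    have h := hsmall k
    rw [reForm_apply, (ha k).star_eq] at h
    have e : (τ (b k)).re = ((2 : ℝ) ^ k) ^ 2 * (τ (a k * a k)).re := by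
      simp only [b, ← Complex.coe_smul, map_smul, smul_eq_mul, Complex.re_ofReal_mul]
    rw [e]
    calc _ ≤ ((2 : ℝ) ^ k) ^ 2 * (1 / 16) ^ k := by gcongr
      _ = _ := by rw [← pow_mul, mul_comm k, pow_mul, ← mul_pow]; norm_num
  let s : ℕ → ℕ → H →L[ℂ] H := fun N n => ∑ k ∈ Finset.Ico N n, b k
  have hs0 : ∀ N n, 0 ≤ s N n := fun N n => Finset.sum_nonneg fun k _ => hb0 k
  have hsD : ∀ N n, s N n ∈ D := fun N n => sum_mem fun k _ => hbD k
  have hsub : ∀ {N N' n n'}, Finset.Ico N n ⊆ Finset.Ico N' n' → s N n ≤ s N' n' :=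
    fun h => Finset.sum_le_sum_of_subset_of_nonneg h fun k _ _ => hb0 k
  have hsτ : ∀ N n, (τ (s N n)).re ≤ 2 * (1 / 4) ^ N := by
    intro N n
    have h1 := geom_sum_Ico_le_of_lt_one (m := N) (n := n) (x := (1 / 4 : ℝ)) (by norm_num)
      (by norm_num)
    calc (τ (s N n)).re = ∑ k ∈ Finset.Ico N n, (τ (b k)).re := by
          simp only [s, map_sum, Complex.re_sum]
      _ ≤ ∑ k ∈ Finset.Ico N n, (1 / 4 : ℝ) ^ k := Finset.sum_le_sum fun k _ => hbτ k
      _ ≤ _ := h1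
      _ ≤ _ := by
        have : (0 : ℝ) < (1 / 4) ^ N := by positivity
        rw [div_le_iff₀ (by norm_num)]; linarith
  -- The resolvent replaces the indicator of the set where s is small: it is operator antitone in s,
  -- and 1 - g ≤ s bounds the trace of what is cut off.
  let g : ℕ → ℕ → H →L[ℂ] H := fun N n => Ring.inverse (1 + s N n)
  have hgD : ∀ N n, g N n ∈ D := fun N n => ringInverse_mem (add_mem (one_mem D) (hsD N n))
  have hg0 : ∀ N n, 0 ≤ g N n := fun N n => ringInverse_one_add_nonneg (hs0 N n)
  have hg1 : ∀ N n, g N n ≤ 1 := fun N n => ringInverse_one_add_le_one (hs0 N n)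
  have hganti : ∀ {N N' n n'}, Finset.Ico N n ⊆ Finset.Ico N' n' → g N' n' ≤ g N n :=
    fun h => ringInverse_one_add_anti (hs0 _ _) (hsub h)
  have hF : ∀ N, ∃ F ∈ D, 0 ≤ F ∧ F ≤ 1 ∧ IsLUB (Set.range fun n => 1 - g N n) F ∧
      (∀ v, Tendsto (fun n => (1 - g N n) v) atTop (𝓝 (F v))) ∧
      Tendsto (fun n => (τ (1 - g N n)).re) atTop (𝓝 (τ F).re) := fun N =>
    exists_strong_limit_of_monotone hτ hn
      (fun m n hmn => sub_le_sub_left (hganti (Finset.Ico_subset_Ico_right hmn)) 1)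
      (fun n => sub_mem (one_mem D) (hgD N n)) (fun n => sub_nonneg.2 (hg1 N n))
      (fun n => sub_le_self _ (hg0 N n))
  choose F hFD hF0 hF1 hFlub hFv hFτ using hF
  have hFsmall : ∀ N, (τ (F N)).re ≤ 2 * (1 / 4) ^ N := fun N =>
    le_of_tendsto' (hFτ N) fun n =>
      (hτ.re_mono (sub_mem (one_mem D) (hgD N n)) (hsD N n)
        (one_sub_ringInverse_one_add_le (hs0 N n))).trans (hsτ N n)
  have hFanti : Antitone F := by
    intro N N' hN
    refine (hFlub N').2 ?_
    rintro _ ⟨n, rfl⟩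
    exact (sub_le_sub_left (hganti (Finset.Ico_subset_Ico_left hN)) 1).trans
      ((hFlub N).1 ⟨n, rfl⟩)
  obtain ⟨L, hLD, -, hL1, hLlub, hLv, -⟩ := exists_strong_limit_of_monotone hτ hn
    (f := fun N => 1 - F N) (fun m n hmn => sub_le_sub_left (hFanti hmn) 1)
    (fun N => sub_mem (one_mem D) (hFD N)) (fun N => sub_nonneg.2 (hF1 N))
    (fun N => sub_le_self _ (hF0 N))
  -- 1 - L ≤ F N for every N, so τ(1 - L) = 0 and faithfulness applies.
  have hL : L = 1 := by
    have hmem : 1 - L ∈ D := sub_mem (one_mem D) hLD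
    have hpos : 0 ≤ 1 - L := sub_nonneg.2 hL1
    have hle : (τ (1 - L)).re ≤ 0 := by
      refine ge_of_tendsto' (x := atTop) (f := fun N : ℕ => 2 * (1 / 4 : ℝ) ^ N) ?_ fun N => ?_
      · simpa using (tendsto_pow_atTop_nhds_zero_of_lt_one (r := (1 / 4 : ℝ)) (by norm_num)
          (by norm_num)).const_mul 2
      · refine (hτ.re_mono hmem (hFD N) ?_).trans (hFsmall N)
        exact sub_le_comm.1 (hLlub.1 ⟨N, rfl⟩)
    have h0 : τ (1 - L) = 0 := Complex.ext (le_antisymm hle (hτ.re_nonneg hmem hpos))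
      (hτ.im_eq_zero hmem (IsSelfAdjoint.of_nonneg hpos))
    exact (sub_eq_zero.1 (hf _ hmem hpos h0)).symm
  refine ⟨fun N => 1 - F N, fun N => sub_mem (one_mem D) (hFD N), fun N => sub_nonneg.2 (hF1 N),
    fun N => sub_le_self _ (hF0 N), fun N => ?_, fun v => ?_, fun N k hk v => ?_⟩
  · simpa using hFsmall N
  · simpa [hL] using hLv v
  · have ht : Tendsto (fun n => ‖a k (g N n v)‖) atTop (𝓝 ‖a k ((1 - F N) v)‖) := by
      refine (((a k).continuous.tendsto _).comp ?_).norm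
      have := (tendsto_const_nhds (x := v)).sub (hFv N v)
      simpa using this
    refine le_of_tendsto ht ?_
    filter_upwards [Ici_mem_atTop (k + 1)] with n hnk
    have h := norm_apply_ringInverse_one_add_le (c := 2 ^ k) (ha k) (hs0 N n)
      (Finset.single_le_sum (f := b) (fun k _ => hb0 k) (Finset.mem_Ico.2 ⟨hk, hnk⟩)) v
    rw [abs_of_pos (by positivity)] at h
    calc ‖a k (g N n v)‖ = (1 / 2) ^ k * (2 ^ k * ‖a k (g N n v)‖) := by
          rw [← mul_assoc, ← mul_pow]; norm_num
      _ ≤ _ := by gcongr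

/-- Sequential completeness of the order interval `[0, 1]` of `D` in the two-norm of a faithful
normal functional. -/
theorem exists_limit_of_reForm_le {D : VonNeumannAlgebra H} {τ : (H →L[ℂ] H) →ₗ[ℂ] ℂ}
    (hτ : D.IsPositiveOn τ) (hn : D.IsNormalOn τ) (hone : τ 1 = 1)
    (hf : ∀ a ∈ D, 0 ≤ a → τ a = 0 → a = 0) {h : ℕ → H →L[ℂ] H} (hD : ∀ n, h n ∈ D)
    (h0 : ∀ n, 0 ≤ h n) (h1 : ∀ n, h n ≤ 1)
    (hsmall : ∀ n, reForm τ (h n - h (n + 1)) (h n - h (n + 1)) ≤ (1 / 16) ^ n) :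
    ∃ t ∈ D, 0 ≤ t ∧ t ≤ 1 ∧
      Tendsto (fun n => reForm τ (h n - t) (h n - t)) atTop (𝓝 0) := by
  have hnorm : ∀ n, ‖h n‖ ≤ 1 := fun n => (CStarAlgebra.norm_le_one_iff_of_nonneg _ (h0 n)).2 (h1 n)
  obtain ⟨G, hGD, hG0, hG1, hGτ, hGv, hGa⟩ := exists_monotone_cutoff hτ hn hf
    (a := fun n => h n - h (n + 1)) (fun n => sub_mem (hD n) (hD _))
    (fun n => (IsSelfAdjoint.of_nonneg (h0 n)).sub (IsSelfAdjoint.of_nonneg (h0 _))) hsmall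
  have hgeo : ∀ N v n, dist (h (N + n) (G N v)) (h (N + (n + 1)) (G N v)) ≤
      (2 * ((1 / 2) ^ N * ‖v‖)) / 2 / 2 ^ n := by
    intro N v n
    have := hGa N (N + n) (by omega) v
    rw [dist_eq_norm]
    refine this.trans (le_of_eq ?_)
    rw [pow_add, one_div, inv_pow, inv_pow]
    field_simp
  -- On vectors G N v the sequence is geometrically Cauchy; such vectors approximate v, and the h n
  -- are uniformly bounded.
  have hcau : ∀ v, CauchySeq fun n => h n v := by
    intro v
    rw [Metric.cauchySeq_iff']
    intro ε hε
    obtain ⟨N, hN⟩ := ((hGv v).eventually (Metric.ball_mem_nhds v (show 0 < ε / 3 by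
      positivity))).exists
    rw [dist_comm, dist_eq_norm] at hN
    have hc := cauchySeq_of_le_geometric_two (hgeo N v)
    obtain ⟨m, hm⟩ := Metric.cauchySeq_iff'.1 hc (ε / 3) (by positivity)
    have hclose : ∀ k, dist (h k v) (h k (G N v)) < ε / 3 := by
      intro k
      rw [dist_eq_norm, ← map_sub]
      exact ((h k).le_of_opNorm_le (hnorm k) _).trans_lt (by rwa [one_mul])
    refine ⟨N + m, fun k hk => ?_⟩
    obtain ⟨j, rfl⟩ := Nat.exists_eq_add_of_le hk
    have h3 := hm (m + j) (by omega)
    rw [← add_assoc] at h3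
    have h4 := dist_triangle4 (h (N + m + j) v) (h (N + m + j) (G N v)) (h (N + m) (G N v))
      (h (N + m) v)
    have h5 := hclose (N + m)
    rw [dist_comm] at h5
    linarith [hclose (N + m + j)]
  obtain ⟨t, ht⟩ := exists_forall_tendsto_of_norm_le hnorm fun v =>
    cauchySeq_tendsto_of_complete (hcau v)
  have htD : t ∈ D := mem_of_tendsto hD ht
  have ht0 : 0 ≤ t := nonneg_of_forall_tendsto (Eventually.of_forall h0) ht
  have ht1 : t ≤ 1 := le_of_forall_tendsto (Eventually.of_forall h1) ht
  have htn : ‖t‖ ≤ 1 := (CStarAlgebra.norm_le_one_iff_of_nonneg _ ht0).2 ht1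
  refine ⟨t, htD, ht0, ht1, ?_⟩
  have hyG : ∀ N, ‖(h N - t) * G N‖ ≤ 2 * (1 / 2) ^ N := by
    intro N
    refine ContinuousLinearMap.opNorm_le_bound _ (by positivity) fun v => ?_
    have htl : Tendsto (fun n => h (N + n) (G N v)) atTop (𝓝 (t (G N v))) :=
      (ht (G N v)).comp (tendsto_add_atTop_nat N |>.congr fun n => add_comm _ _)
    have := dist_le_of_le_geometric_two_of_tendsto₀ (hgeo N v) htl
    rw [dist_eq_norm, add_zero] at this
    rw [mul_assoc]
    exact this
  have hmain : ∀ N, reForm τ (h N - t) (h N - t) ≤ 4 * (1 / 2) ^ N + 8 * (1 / 2) ^ N := by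
    intro N
    set y := h N - t with hy
    have hyD : y ∈ D := sub_mem (hD N) htD
    have hysa : IsSelfAdjoint y := (IsSelfAdjoint.of_nonneg (h0 N)).sub (IsSelfAdjoint.of_nonneg ht0)
    have hyn : ‖y‖ ≤ 2 := (norm_sub_le _ _).trans (by linarith [hnorm N])
    have hyGD : y * G N ∈ D := mul_mem hyD (hGD N)
    have h1G : 1 - G N ∈ D := sub_mem (one_mem D) (hGD N)
    have h1G0 : 0 ≤ 1 - G N := sub_nonneg.2 (hG1 N)
    -- Splitting y² = y(y G) + y²(1 - G): the first term is small because y G is small in norm, the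
    -- second because 1 - G is small in two-norm. Cauchy–Schwarz handles both.
    have hsplit : reForm τ y y = reForm τ y (y * G N) + reForm τ (y * y) (1 - G N) := by
      rw [reForm_apply τ (y * y), star_mul, hysa.star_eq, reForm_apply, reForm_apply,
        ← Complex.add_re, ← map_add, hysa.star_eq]
      congr 2
      noncomm_ring
    have b1 : reForm τ y (y * G N) ≤ 4 * (1 / 2) ^ N := by
      refine le_of_sq_le_sq ?_ (by positivity)
      calc _ ≤ _ := hτ.reForm_sq_le hyD hyGD
        _ ≤ ‖y‖ ^ 2 * ‖y * G N‖ ^ 2 :=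
          mul_le_mul (hτ.reForm_self_le hone hyD) (hτ.reForm_self_le hone hyGD)
            (hτ.reForm_self_nonneg hyGD) (by positivity)
        _ ≤ 2 ^ 2 * (2 * (1 / 2) ^ N) ^ 2 := by gcongr; exact hyG N
        _ = _ := by ring
    have b2 : reForm τ (y * y) (1 - G N) ≤ 8 * (1 / 2) ^ N := by
      refine le_of_sq_le_sq ?_ (by positivity)
      have hsq : reForm τ (1 - G N) (1 - G N) ≤ 2 * (1 / 4) ^ N := by
        rw [reForm_apply, (IsSelfAdjoint.of_nonneg h1G0).star_eq]
        refine (hτ.re_mono (mul_mem h1G h1G) h1G ?_).trans (hGτ N)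
        refine (mul_self_le_norm_smul_of_nonneg h1G0).trans ?_
        have hle : ‖1 - G N‖ ≤ 1 := (CStarAlgebra.norm_le_one_iff_of_nonneg _ h1G0).2
          (sub_le_self _ (hG0 N))
        calc _ ≤ (1 : ℝ) • (1 - G N) := smul_le_smul_of_nonneg_right hle h1G0
          _ = _ := one_smul _ _
      have hyy : ‖y * y‖ ≤ 4 := (norm_mul_le _ _).trans (by nlinarith [norm_nonneg y])
      calc _ ≤ _ := hτ.reForm_sq_le (mul_mem hyD hyD) h1G
        _ ≤ ‖y * y‖ ^ 2 * (2 * (1 / 4) ^ N) :=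
          mul_le_mul (hτ.reForm_self_le hone (mul_mem hyD hyD)) hsq
            (hτ.reForm_self_nonneg h1G) (by positivity)
        _ ≤ 4 ^ 2 * (2 * (1 / 4) ^ N) := by gcongr
        _ ≤ 64 * (1 / 4) ^ N := by
          have : (0 : ℝ) < (1 / 4) ^ N := by positivity
          linarith
        _ = _ := by
          rw [mul_pow, ← pow_mul, mul_comm N 2, pow_mul]; norm_num
    linarith
  refine squeeze_zero (fun N => hτ.reForm_self_nonneg (sub_mem (hD N) htD)) hmain ?_
  have := tendsto_pow_atTop_nhds_zero_of_lt_one (r := (1 / 2 : ℝ)) (by norm_num) (by norm_num)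
  simpa using (this.const_mul 4).add (this.const_mul 8)

end VonNeumannAlgebra

end TwoNorm

/-! ### Densities in `D` for the functionals ω(x ·). -/

section RadonNikodym

/-- For self-adjoint `d` with positive part `p` there is `0 ≤ k ≤ 1`, a continuous function of `d`,
with `d k` uniformly close to `p`. -/
theorem IsSelfAdjoint.exists_cfc_mul_approx_posPart {A : Type*} [CStarAlgebra A] [PartialOrder A]
    [StarOrderedRing A] {d : A} (hd : IsSelfAdjoint d) {η : ℝ} (hη : 0 < η) :
    ∃ f : ℝ → ℝ, 0 ≤ cfc f d ∧ cfc f d ≤ 1 ∧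
      cfc (fun t : ℝ => max t 0) d - η • (1 : A) ≤ d * cfc f d := by
  have hpos : ∀ t : ℝ, 0 < max t 0 + η := fun t => add_pos_of_nonneg_of_pos (le_max_right _ _) hη
  have hc : Continuous fun t : ℝ => max t 0 / (max t 0 + η) :=
    Continuous.div (by fun_prop) (by fun_prop) fun t => (hpos t).ne'
  -- A continuous stand-in for the indicator of t > 0; for t ≥ 0, t²/(t + η) ≥ t - η because t² ≥ t²
  -- - η².
  refine ⟨fun t => max t 0 / (max t 0 + η), ?_, ?_, ?_⟩
  · exact cfc_nonneg fun t _ => div_nonneg (le_max_right _ _) (hpos t).le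
  · refine cfc_le_one _ _ fun t _ => (div_le_one (hpos t)).2 (by linarith)
  · have h1 : cfc (fun t : ℝ => max t 0) d - η • (1 : A) = cfc (fun t : ℝ => max t 0 - η) d := by
      rw [cfc_sub (fun t : ℝ => max t 0) (fun _ => η) d (by fun_prop) (by fun_prop),
        cfc_const η d, Algebra.algebraMap_eq_smul_one]
    have h2 : d * cfc (fun t : ℝ => max t 0 / (max t 0 + η)) d
        = cfc (fun t : ℝ => t * (max t 0 / (max t 0 + η))) d := by
      rw [cfc_mul (fun t : ℝ => t) _ d (by fun_prop) hc.continuousOn, cfc_id' ℝ d]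
    rw [h1, h2]
    refine cfc_mono (fun t _ => ?_) (by fun_prop) (by
      exact (continuous_id.mul hc).continuousOn)
    rcases le_total t 0 with ht | ht
    · simp [max_eq_right ht, hη.le]
    · rw [max_eq_left ht, ← mul_div_assoc, le_div_iff₀ (by linarith)]
      nlinarith

theorem IsSelfAdjoint.cfc_max_zero {A : Type*} [CStarAlgebra A] [PartialOrder A]
    [StarOrderedRing A] {d : A} (hd : IsSelfAdjoint d) :
    0 ≤ cfc (fun t : ℝ => max t 0) d ∧ d ≤ cfc (fun t : ℝ => max t 0) d := by
  refine ⟨cfc_nonneg fun t _ => le_max_right _ _, ?_⟩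
  conv_lhs => rw [← cfc_id' ℝ d]
  exact cfc_mono (fun t _ => le_max_left _ _) (by fun_prop) (by fun_prop)

variable {H : Type*} [NormedAddCommGroup H] [InnerProductSpace ℂ H] [CompleteSpace H]

namespace VonNeumannAlgebra

variable {M D : VonNeumannAlgebra H} {ω : (H →L[ℂ] H) →ₗ[ℂ] ℂ}

theorem sqrt_mem {a : H →L[ℂ] H} (ha : a ∈ D) : CFC.sqrt a ∈ D :=
  mem_of_forall_commute fun _ hb => (commute_of_mem_commutant ha hb).cfcₙ_nnreal _

/-- Centrality of √c gives ω(z c) = ω(√c z √c). -/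
theorem IsPositiveOn.apply_mul_nonneg (hω : M.IsPositiveOn ω) (hDM : D ≤ M)
    (hcen : ∀ d ∈ D, ∀ x ∈ M, ω (d * x) = ω (x * d)) {z c : H →L[ℂ] H} (hz : z ∈ M) (hz0 : 0 ≤ z)
    (hc : c ∈ D) (hc0 : 0 ≤ c) : 0 ≤ ω (z * c) := by
  have hs := sqrt_mem hc
  have h2 : CFC.sqrt c * CFC.sqrt c = c := CFC.sqrt_mul_sqrt_self c hc0
  have hsa : star (CFC.sqrt c) = CFC.sqrt c := (IsSelfAdjoint.of_nonneg (CFC.sqrt_nonneg c)).star_eq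
  have h3 := star_left_conjugate_nonneg hz0 (CFC.sqrt c)
  rw [hsa] at h3
  have h4 := hω _ (mul_mem (mul_mem (hDM hs) hz) (hDM hs)) h3
  rwa [mul_assoc, hcen _ hs _ (mul_mem hz (hDM hs)), mul_assoc, h2] at h4

theorem exists_nearest_point (hω : M.IsPositiveOn ω) (hDM : D ≤ M) (hn : D.IsNormalOn ω)
    (hone : ω 1 = 1) (hf : ∀ a ∈ D, 0 ≤ a → ω a = 0 → a = 0) {x : H →L[ℂ] H} (hx : x ∈ M) :
    ∃ h ∈ D, 0 ≤ h ∧ h ≤ 1 ∧ ∀ k ∈ D, 0 ≤ k → k ≤ 1 → reForm ω (x - h) (k - h) ≤ 0 := by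
  -- The form is known to be symmetric and positive only on `M`, so it is restricted to `M` as a
  -- real vector space.
  let U : Submodule ℝ (H →L[ℂ] H) :=
    M.toStarSubalgebra.toSubalgebra.toSubmodule.restrictScalars ℝ
  have hωD : D.IsPositiveOn ω := fun a ha => hω a (hDM ha)
  obtain ⟨h, ⟨hD, h0, h1⟩, hmin⟩ :=
    LinearMap.BilinForm.exists_mem_forall_apply_sub_sub_nonpos (B := (reForm ω).restrict U)
      (S := {u : U | (u : H →L[ℂ] H) ∈ D ∧ 0 ≤ (u : H →L[ℂ] H) ∧ (u : H →L[ℂ] H) ≤ 1})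
      (fun u v => hω.reForm_comm u.2 v.2) (fun v => hω.reForm_self_nonneg v.2)
      ⟨0, zero_mem D, le_rfl, zero_le_one⟩ (by
        rintro u ⟨huD, hu0, hu1⟩ v ⟨hvD, hv0, hv1⟩ r s hr hs hrs
        refine ⟨add_mem (smul_mem_real huD r) (smul_mem_real hvD s),
          add_nonneg (smul_nonneg hr hu0) (smul_nonneg hs hv0), ?_⟩
        calc r • (u : H →L[ℂ] H) + s • (v : H →L[ℂ] H) ≤ r • 1 + s • 1 :=
              add_le_add (smul_le_smul_of_nonneg_left hu1 hr) (smul_le_smul_of_nonneg_left hv1 hs)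
          _ = 1 := by rw [← add_smul, hrs, one_smul]) (by
        intro u hu hsmall
        obtain ⟨t, htD, ht0, ht1, ht⟩ := exists_limit_of_reForm_le hωD hn hone hf
          (fun n => (hu n).1) (fun n => (hu n).2.1) (fun n => (hu n).2.2) hsmall
        exact ⟨⟨t, hDM htD⟩, ⟨htD, ht0, ht1⟩, ht⟩) ⟨x, hx⟩
  exact ⟨h, hD, h0, h1, fun k hk hk0 hk1 => hmin ⟨k, hDM hk⟩ ⟨hk, hk0, hk1⟩⟩

theorem exists_approx_projection (hω : M.IsPositiveOn ω) (hDM : D ≤ M) {y : H →L[ℂ] H}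
    (hy : y ∈ M) {ε : ℝ} (hε : 0 < ε) :
    ∃ d ∈ D, IsSelfAdjoint d ∧ ∀ k ∈ D, IsSelfAdjoint k →
      |reForm ω (y - d) k| ≤ ε * √(reForm ω k k) := by
  let U : Submodule ℝ (H →L[ℂ] H) :=
    M.toStarSubalgebra.toSubalgebra.toSubmodule.restrictScalars ℝ
  let W : Submodule ℝ U :=
    { carrier := {u | (u : H →L[ℂ] H) ∈ D ∧ IsSelfAdjoint (u : H →L[ℂ] H)}
      add_mem' := fun hu hv => ⟨add_mem hu.1 hv.1, hu.2.add hv.2⟩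
      zero_mem' := ⟨zero_mem D, IsSelfAdjoint.zero _⟩
      smul_mem' := fun r u hu => ⟨smul_mem_real hu.1 r, (IsSelfAdjoint.all r).smul hu.2⟩ }
  obtain ⟨d, hd, h⟩ := LinearMap.BilinForm.exists_mem_abs_apply_sub_le (B := (reForm ω).restrict U)
    (fun u v => hω.reForm_comm u.2 v.2) (fun v => hω.reForm_self_nonneg v.2) W ⟨y, hy⟩ hε
  exact ⟨d, hd.1, hd.2, fun k hk hks => h ⟨k, hDM hk⟩ ⟨hk, hks⟩⟩

/-- A Radon–Nikodym theorem: if `D` is in the centralizer of `ω`, the functional `ω (x ·)` on `D`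
has a density in `D`. -/
theorem exists_density_of_le_one (hω : M.IsPositiveOn ω) (hDM : D ≤ M) (hn : D.IsNormalOn ω)
    (hone : ω 1 = 1) (hf : ∀ a ∈ D, 0 ≤ a → ω a = 0 → a = 0)
    (hcen : ∀ d ∈ D, ∀ x ∈ M, ω (d * x) = ω (x * d)) {x : H →L[ℂ] H} (hx : x ∈ M) (hx0 : 0 ≤ x)
    (hx1 : x ≤ 1) : ∃ h ∈ D, 0 ≤ h ∧ h ≤ 1 ∧ ∀ d ∈ D, ω (x * d) = ω (h * d) := by
  obtain ⟨h, hD, h0, h1, hmin⟩ := exists_nearest_point hω hDM hn hone hf hx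
  have hhM := hDM hD
  have hyM : x - h ∈ M := sub_mem hx hhM
  have hxsa := IsSelfAdjoint.of_nonneg hx0
  have hhsa := IsSelfAdjoint.of_nonneg h0
  have hhn : ‖h‖ ≤ 1 := (CStarAlgebra.norm_le_one_iff_of_nonneg _ h0).2 h1
  have hysa := hxsa.sub hhsa
  -- With p = d₊ and k ≈ 1_{d > 0}: ω(xd) ≤ ω(xp) ≤ ω(p) ≤ ω(dk) + ε. Hence ⟨x - h, d⟩ ≤ ⟨d, k - h⟩
  -- + ε ≤ ⟨x - h, k - h⟩ + 2ε + ε, and minimality of h makes the last inner product nonpositive.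
  have hupper : ∀ d ∈ D, IsSelfAdjoint d → ∀ ε : ℝ, 0 < ε →
      (∀ k ∈ D, IsSelfAdjoint k → |reForm ω (x - h - d) k| ≤ ε * √(reForm ω k k)) →
      reForm ω (x - h) d ≤ 3 * ε := by
    intro d hd hdsa ε hε happ
    obtain ⟨f, hk0, hk1, hk⟩ := hdsa.exists_cfc_mul_approx_posPart hε
    have hkD : cfc f d ∈ D := cfc_mem hd f
    obtain ⟨hp0, hdp⟩ := hdsa.cfc_max_zero
    have hpD : cfc (fun t : ℝ => max t 0) d ∈ D := cfc_mem hd _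
    have hkn : ‖cfc f d‖ ≤ 1 := (CStarAlgebra.norm_le_one_iff_of_nonneg _ hk0).2 hk1
    generalize cfc f d = k at *
    generalize cfc (fun t : ℝ => max t 0) d = p at *
    have i1 : 0 ≤ (ω (x * (p - d))).re := (Complex.le_def.1
      (hω.apply_mul_nonneg hDM hcen hx hx0 (sub_mem hpD hd) (sub_nonneg.2 hdp))).1
    have i2 : 0 ≤ (ω ((1 - x) * p)).re := (Complex.le_def.1
      (hω.apply_mul_nonneg hDM hcen (sub_mem (one_mem M) hx) (sub_nonneg.2 hx1) hpD hp0)).1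
    have i3 := hω.re_mono (sub_mem (hDM hpD) (smul_mem_real (one_mem M) ε))
      (mul_mem (hDM hd) (hDM hkD)) hk
    rw [map_sub, ← Complex.coe_smul, map_smul, hone] at i3
    have i4 := hmin k hkD hk0 hk1
    have i5 := happ (k - h) (sub_mem hkD hD) ((IsSelfAdjoint.of_nonneg hk0).sub hhsa)
    have i6 : √(reForm ω (k - h) (k - h)) ≤ 2 := by
      rw [Real.sqrt_le_left (by norm_num)]
      have hle : ‖k - h‖ ≤ 2 := (norm_sub_le _ _).trans (by linarith)
      calc _ ≤ ‖k - h‖ ^ 2 := hω.reForm_self_le hone (hDM (sub_mem hkD hD))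
        _ ≤ 2 ^ 2 := by gcongr
    have i7 : ε * √(reForm ω (k - h) (k - h)) ≤ ε * 2 := by gcongr
    generalize √(reForm ω (k - h) (k - h)) = r at *
    have i8 := (abs_le.1 i5).1
    have i9 := hcen d hd h hhM
    rw [map_sub (reForm ω) (x - h) d, LinearMap.sub_apply] at i8
    rw [reForm_apply ω d, hdsa.star_eq, mul_sub, map_sub ω, i9] at i8
    rw [reForm_apply, hysa.star_eq, sub_mul, map_sub]
    rw [mul_sub, map_sub] at i1
    rw [sub_mul, one_mul, map_sub] at i2
    simp only [Complex.sub_re, smul_eq_mul, mul_one, Complex.ofReal_re] at *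
    linarith
  have hzero : ∀ k ∈ D, IsSelfAdjoint k → reForm ω (x - h) k = 0 := by
    intro k hk hksa
    set c := √(reForm ω k k) with hc
    have hbound : ∀ ε : ℝ, 0 < ε → ε ≤ 1 → |reForm ω (x - h) k| ≤ (ε + √(7 * ε)) * c := by
      intro ε hε hε1
      obtain ⟨d, hd, hdsa, happ⟩ := exists_approx_projection hω hDM hyM hε
      have j1 := hupper d hd hdsa ε hε happ
      have j2 := (abs_le.1 (happ d hd hdsa)).1
      rw [map_sub, LinearMap.sub_apply] at j2
      have hq0 := hω.reForm_self_nonneg (hDM hd)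
      -- With q = ‖d‖₂, the bounds give q² ≤ 3ε + εq, hence q² ≤ 6ε + ε² ≤ 7ε for ε ≤ 1.
      have j3 := Real.sq_sqrt hq0
      have j4 : reForm ω d d ≤ 7 * ε := by
        nlinarith [sq_nonneg (√(reForm ω d d) - ε)]
      have j5 := happ k hk hksa
      rw [map_sub, LinearMap.sub_apply] at j5
      have j6 : |reForm ω d k| ≤ √(7 * ε) * c := by
        rw [hc, ← Real.sqrt_mul (by positivity)]
        refine Real.abs_le_sqrt ((hω.reForm_sq_le (hDM hd) (hDM hk)).trans ?_)
        exact mul_le_mul_of_nonneg_right j4 (hω.reForm_self_nonneg (hDM hk))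
      have j7 := abs_add_le (reForm ω (x - h) k - reForm ω d k) (reForm ω d k)
      rw [sub_add_cancel] at j7
      linarith
    have ht : Tendsto (fun ε : ℝ => (ε + √(7 * ε)) * c) (𝓝[>] 0) (𝓝 ((0 + √(7 * 0)) * c)) :=
      (Continuous.tendsto (by fun_prop) 0).mono_left nhdsWithin_le_nhds
    have : |reForm ω (x - h) k| ≤ (0 + √(7 * 0)) * c := by
      refine ge_of_tendsto ht ?_
      filter_upwards [Ioc_mem_nhdsGT (show (0 : ℝ) < 1 by norm_num)] with ε hε
      exact hbound ε hε.1 hε.2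
    simpa using this
  have hzero' : ∀ k ∈ D, IsSelfAdjoint k → ω ((x - h) * k) = 0 := by
    intro k hk hksa
    have e1 := hzero k hk hksa
    rw [reForm_apply, hysa.star_eq] at e1
    -- The form sees only the real part; centrality makes ω((x - h)k) equal to its own conjugate.
    have e2 := hω.map_star (mul_mem hyM (hDM hk))
    rw [star_mul, hysa.star_eq, hksa.star_eq, hcen k hk _ hyM] at e2
    exact Complex.ext e1 (Complex.conj_eq_iff_im.1 e2.symm)
  refine ⟨h, hD, h0, h1, fun d hd => ?_⟩
  have e1 := hzero' _ (add_mem hd (star_mem hd)) (IsSelfAdjoint.add_star_self d)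
  have e2 := hzero' (Complex.I • (d - star d))
    (SMulMemClass.smul_mem _ (sub_mem hd (star_mem hd))) (by
      rw [IsSelfAdjoint, star_smul, star_sub, star_star]
      simp only [Complex.star_def, Complex.conj_I, neg_smul, smul_sub]
      abel)
  rw [mul_smul_comm, map_smul, smul_eq_zero, or_iff_right Complex.I_ne_zero, mul_sub, map_sub] at e2
  rw [mul_add, map_add] at e1
  have e3 : ω ((x - h) * d) = 0 := by linear_combination (e1 + e2) / 2
  rwa [sub_mul, map_sub, sub_eq_zero] at e3

end VonNeumannAlgebra

end RadonNikodym

/-! ### Construction and uniqueness of the conditional expectation. -/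

section ConditionalExpectation

variable {H : Type*} [NormedAddCommGroup H] [InnerProductSpace ℂ H] [CompleteSpace H]

namespace VonNeumannAlgebra

variable {M D : VonNeumannAlgebra H}

/-- A purely algebraic extension, nothing being claimed off `M`; it lets computations take place
among operators instead of in a subtype. -/
theorem exists_extend_linearMap (ω : M →ₗ[ℂ] ℂ) :
    ∃ φ : (H →L[ℂ] H) →ₗ[ℂ] ℂ, ∀ x : M, φ x = ω x := by
  obtain ⟨φ, hφ⟩ := LinearMap.exists_extend (p := M.toStarSubalgebra.toSubalgebra.toSubmodule) ω
  exact ⟨φ, fun x => LinearMap.congr_fun hφ x⟩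

theorem IsPositiveOn.mono {φ : (H →L[ℂ] H) →ₗ[ℂ] ℂ} (h : M.IsPositiveOn φ) (hDM : D ≤ M) :
    D.IsPositiveOn φ := fun a ha => h a (hDM ha)

theorem IsNormalOn.mono {φ : (H →L[ℂ] H) →ₗ[ℂ] ℂ} (h : M.IsNormalOn φ) (hDM : D ≤ M) :
    D.IsNormalOn φ := fun S hS hne hd h0 s hs => h S (hS.trans hDM) hne hd h0 s (hDM hs)

theorem isNormalOn_of_isNormalMap {ω : M →ₗ[ℂ] ℂ} (hω : IsNormalMap ω)
    {φ : (H →L[ℂ] H) →ₗ[ℂ] ℂ} (hφ : ∀ x : M, φ x = ω x) : M.IsNormalOn φ := by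
  intro S hS hne hd h0 s hs hlub
  have himg : ω '' {x : M | (x : H →L[ℂ] H) ∈ S} = φ '' S := by
    ext z
    constructor
    · rintro ⟨x, hx, rfl⟩
      exact ⟨x, hx, hφ x⟩
    · rintro ⟨x, hx, rfl⟩
      exact ⟨⟨x, hS hx⟩, hx, (hφ _).symm⟩
  rw [← himg, hφ ⟨s, hs⟩]
  refine hω _ ?_ ?_ (fun x hx => h0 x hx) _ ⟨fun x hx => hlub.1 hx, fun u hu => ?_⟩
  · obtain ⟨x, hx⟩ := hne
    exact ⟨⟨x, hS hx⟩, hx⟩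
  · intro x hx y hy
    obtain ⟨z, hz, hxz, hyz⟩ := hd x hx y hy
    exact ⟨⟨z, hS hz⟩, hz, hxz, hyz⟩
  · exact hlub.2 fun x hx => hu (show (⟨x, hS hx⟩ : M) ∈ {x : M | (x : H →L[ℂ] H) ∈ S} from hx)

theorem exists_density_of_nonneg {ω : (H →L[ℂ] H) →ₗ[ℂ] ℂ} (hω : M.IsPositiveOn ω) (hDM : D ≤ M)
    (hn : D.IsNormalOn ω) (hone : ω 1 = 1) (hf : ∀ a ∈ D, 0 ≤ a → ω a = 0 → a = 0)
    (hcen : ∀ d ∈ D, ∀ x ∈ M, ω (d * x) = ω (x * d)) {x : H →L[ℂ] H} (hx : x ∈ M) (hx0 : 0 ≤ x) :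
    ∃ h ∈ D, 0 ≤ h ∧ ∀ d ∈ D, ω (x * d) = ω (h * d) := by
  have hr : 0 < ‖x‖ + 1 := by positivity
  obtain ⟨h, hD, h0, -, hh⟩ := exists_density_of_le_one hω hDM hn hone hf hcen
    (smul_mem_real hx (‖x‖ + 1)⁻¹) (smul_nonneg (by positivity) hx0) (by
      refine (CStarAlgebra.norm_le_one_iff_of_nonneg _ (smul_nonneg (by positivity) hx0)).1 ?_
      rw [norm_smul, Real.norm_of_nonneg (by positivity), inv_mul_le_one₀ hr]
      linarith)
  refine ⟨(‖x‖ + 1) • h, smul_mem_real hD _, smul_nonneg hr.le h0, fun d hd => ?_⟩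
  have := hh d hd
  rw [smul_mul_assoc, ← Complex.coe_smul, map_smul] at this
  rw [smul_mul_assoc, ← Complex.coe_smul, map_smul, ← this, smul_smul, ← Complex.ofReal_mul,
    mul_inv_cancel₀ hr.ne']
  simp

theorem exists_density {ω : (H →L[ℂ] H) →ₗ[ℂ] ℂ} (hω : M.IsPositiveOn ω) (hDM : D ≤ M)
    (hn : D.IsNormalOn ω) (hone : ω 1 = 1) (hf : ∀ a ∈ D, 0 ≤ a → ω a = 0 → a = 0)
    (hcen : ∀ d ∈ D, ∀ x ∈ M, ω (d * x) = ω (x * d)) {x : H →L[ℂ] H} (hx : x ∈ M) :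
    ∃ h ∈ D, ∀ d ∈ D, ω (x * d) = ω (h * d) := by
  have hsa : ∀ a ∈ M, IsSelfAdjoint a → ∃ h ∈ D, ∀ d ∈ D, ω (a * d) = ω (h * d) := by
    intro a ha hasa
    have hpos : 0 ≤ a + ‖a‖ • (1 : H →L[ℂ] H) := by
      have := hasa.neg_algebraMap_norm_le_self
      rw [Algebra.algebraMap_eq_smul_one] at this
      simpa using add_le_add_left this (‖a‖ • (1 : H →L[ℂ] H))
    obtain ⟨h, hD, -, hh⟩ := exists_density_of_nonneg hω hDM hn hone hf hcen
      (add_mem ha (smul_mem_real (one_mem M) ‖a‖)) hpos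
    refine ⟨h - ‖a‖ • 1, sub_mem hD (smul_mem_real (one_mem D) _), fun d hd => ?_⟩
    have := hh d hd
    rw [add_mul, map_add] at this
    rw [sub_mul, map_sub, ← this]
    abel
  obtain ⟨h, hD, hh⟩ := hsa _ (add_mem hx (star_mem hx)) (IsSelfAdjoint.add_star_self x)
  obtain ⟨k, kD, hk⟩ := hsa (Complex.I • (x - star x))
    (SMulMemClass.smul_mem _ (sub_mem hx (star_mem hx))) (by
      rw [IsSelfAdjoint, star_smul, star_sub, star_star]
      simp only [Complex.star_def, Complex.conj_I, neg_smul, smul_sub]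
      abel)
  -- Mirrors x = ((x + x⋆) - i · i(x - x⋆)) / 2.
  refine ⟨(1 / 2 : ℂ) • (h - Complex.I • k),
    SMulMemClass.smul_mem _ (sub_mem hD (SMulMemClass.smul_mem _ kD)), fun d hd => ?_⟩
  have e1 := hh d hd
  have e2 := hk d hd
  simp only [add_mul, sub_mul, smul_mul_assoc, map_add, map_sub, map_smul, smul_eq_mul] at e1 e2 ⊢
  linear_combination (1 / 2) * e1 - (Complex.I / 2) * e2
    + (1 / 2) * (ω (x * d) - ω (star x * d)) * Complex.I_sq

/-- Testing with d = y⋆ gives ω(y y⋆) = 0. This is the uniqueness of densities. -/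
theorem eq_zero_of_forall_apply_mul {ω : M →ₗ[ℂ] ℂ} {hDM : D ≤ M}
    (hfaith : IsFaithfulMap (ω ∘ₗ incl hDM)) {y : D} (h : ∀ d : D, ω (incl hDM (y * d)) = 0) :
    y = 0 := by
  have h1 : y * star y = 0 := hfaith _ (mul_star_self_nonneg (y : H →L[ℂ] H)) (h (star y))
  have h2 : (y : H →L[ℂ] H) * star (y : H →L[ℂ] H) = 0 := congrArg Subtype.val h1
  exact Subtype.ext (CStarRing.mul_star_self_eq_zero_iff _ |>.1 h2)

/-- Polarization, from the trace identity at x + y and x + i y. -/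
theorem IsTracial.apply_mul_comm {φ : D →ₗ[ℂ] ℂ} (h : D.IsTracial φ) (a b : D) :
    φ (a * b) = φ (b * a) := by
  have key : ∀ x y : D, φ (star x * y) = φ (y * star x) := by
    intro x y
    have e1 := h (x + y)
    have e2 := h (x + Complex.I • y)
    have ex := h x
    have ey := h y
    have hI : star (Complex.I • y) = -(Complex.I • star y) :=
      Subtype.ext (by
        change star (Complex.I • (y : H →L[ℂ] H)) = -(Complex.I • star (y : H →L[ℂ] H))
        rw [star_smul, Complex.star_def, Complex.conj_I, neg_smul])
    have m1 : ∀ u v : D, (Complex.I • u) * v = Complex.I • (u * v) := fun u v =>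
      Subtype.ext (smul_mul_assoc Complex.I (u : H →L[ℂ] H) (v : H →L[ℂ] H))
    have m2 : ∀ u v : D, u * (Complex.I • v) = Complex.I • (u * v) := fun u v =>
      Subtype.ext (mul_smul_comm Complex.I (u : H →L[ℂ] H) (v : H →L[ℂ] H))
    simp only [star_add, hI, add_mul, mul_add, neg_mul, mul_neg, m1, m2, map_add, map_neg, map_smul,
      smul_eq_mul] at e1 e2
    linear_combination (1 / 2) * (e1 - ex - ey) - (Complex.I / 2) * (e2 - ex - ey)
      + ((φ (star x * y) - φ (star y * x) - φ (y * star x) + φ (x * star y)) / 2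
        - Complex.I / 2 * (φ (star y * y) - φ (y * star y))) * Complex.I_sq
  simpa using key (star a) b

/-- A positive map onto `D` preserving a normal state that is faithful on `D` is normal. -/
theorem isNormalMap_of_preserves {ω : M →ₗ[ℂ] ℂ} (hω : M.IsNormalState ω) (hDM : D ≤ M)
    (hfaith : IsFaithfulMap (ω ∘ₗ incl hDM)) {E : M →ₗ[ℂ] D} (hpos : IsPositiveMap E)
    (hE : Preserves hDM ω E) : IsNormalMap E := by
  obtain ⟨φ, hφ⟩ := exists_extend_linearMap ω
  have hφn : D.IsNormalOn φ := (isNormalOn_of_isNormalMap hω.normal hφ).mono hDM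
  have hφE : ∀ x : M, φ (E x) = ω x := fun x => (hφ (incl hDM (E x))).trans (hE x)
  have hmono : ∀ x y : M, x ≤ y → (E x : H →L[ℂ] H) ≤ E y := by
    intro x y hxy
    have h : (0 : D) ≤ E (y - x) := hpos _ (show (0 : H →L[ℂ] H) ≤ y - x from sub_nonneg.2 hxy)
    rw [map_sub] at h
    exact sub_nonneg.1 (show (0 : H →L[ℂ] H) ≤ E y - E x from h)
  intro S hne hd h0 s hs
  have : Nonempty S := hne.to_subtype
  have : IsDirectedOrder S := directedOn_iff_isDirectedOrder.1 hd
  let f : S → H →L[ℂ] H := fun x => E x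
  obtain ⟨t, hlub, ht⟩ := ContinuousLinearMap.exists_isLUB_tendsto_of_monotone (f := f)
    (fun x y hxy => hmono _ _ hxy) (fun x => hpos _ (h0 x x.2)) (b := E s)
    (fun x => hmono _ _ (hs.1 x.2))
  have htD : t ∈ D := mem_of_tendsto (f := f) (fun x => (E (x : M)).2) ht
  have hfm : Monotone f := fun x y hxy => hmono _ _ hxy
  have h1 := hφn (Set.range f) (by rintro _ ⟨x, rfl⟩; exact (E (x : M)).2) (Set.range_nonempty f)
    (directedOn_range.2 hfm.directed_le) (by rintro _ ⟨x, rfl⟩; exact hpos _ (h0 x x.2)) t htD hlub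
  have himg : φ '' Set.range f = ω '' S := by
    rw [← Set.range_comp, Set.image_eq_range]
    exact congrArg Set.range (funext fun x => hφE x)
  rw [himg] at h1
  -- The supremum t of E(S) satisfies t ≤ E(s), and both have the value sup ω(S) = ω(s);
  -- faithfulness on `D` makes them equal.
  have h2 : φ t = φ (E s) := (h1.unique (hω.normal S hne hd h0 s hs)).trans (hφE s).symm
  have hts : t ≤ E s := hlub.2 (by rintro _ ⟨x, rfl⟩; exact hmono _ _ (hs.1 x.2))
  have h3 : E s - ⟨t, htD⟩ = 0 := by
    refine hfaith _ (show (0 : H →L[ℂ] H) ≤ E s - t from sub_nonneg.2 hts) ?_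
    have h4 : φ ((E s : H →L[ℂ] H) - t) = 0 := by rw [map_sub, h2, sub_self]
    exact (hφ (incl hDM (E s - (⟨t, htD⟩ : D)))).symm.trans h4
  rw [sub_eq_zero.1 h3]
  refine ⟨?_, fun u hu => ?_⟩
  · rintro _ ⟨x, hx, rfl⟩
    exact hlub.1 ⟨⟨x, hx⟩, rfl⟩
  · refine hlub.2 ?_
    rintro _ ⟨x, rfl⟩
    exact hu ⟨x, x.2, rfl⟩

theorem exists_isNormalCondExp_of_centralizes {ω : M →ₗ[ℂ] ℂ} (hω : M.IsNormalState ω)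
    (hDM : D ≤ M) (hfaith : IsFaithfulMap (ω ∘ₗ incl hDM))
    (hcen : ∀ (d : D) (x : M), ω (incl hDM d * x) = ω (x * incl hDM d)) :
    ∃ E : M →ₗ[ℂ] D, IsNormalCondExp hDM E ∧ Preserves hDM ω E := by
  obtain ⟨φ, hφ⟩ := exists_extend_linearMap ω
  have hφp : M.IsPositiveOn φ := fun a ha h => by
    rw [hφ ⟨a, ha⟩]; exact hω.positive ⟨a, ha⟩ h
  have hφn : D.IsNormalOn φ := (isNormalOn_of_isNormalMap hω.normal hφ).mono hDM
  have hφ1 : φ 1 = 1 := (hφ 1).trans hω.map_one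
  have hφf : ∀ a ∈ D, 0 ≤ a → φ a = 0 → a = 0 := fun a ha h0 h =>
    congrArg Subtype.val (hfaith ⟨a, ha⟩ h0 ((hφ (incl hDM ⟨a, ha⟩)).symm.trans h))
  have hφc : ∀ d ∈ D, ∀ x ∈ M, φ (d * x) = φ (x * d) := fun d hd x hx =>
    (hφ (incl hDM ⟨d, hd⟩ * ⟨x, hx⟩)).trans ((hcen ⟨d, hd⟩ ⟨x, hx⟩).trans
      (hφ (⟨x, hx⟩ * incl hDM ⟨d, hd⟩)).symm)
  have hex : ∀ x : M, ∃ h : D, ∀ d : D, ω (x * incl hDM d) = ω (incl hDM (h * d)) := by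
    intro x
    obtain ⟨h, hD, hh⟩ := exists_density hφp hDM hφn hφ1 hφf hφc x.2
    exact ⟨⟨h, hD⟩, fun d => (hφ (x * incl hDM d)).symm.trans
      ((hh d d.2).trans (hφ (incl hDM ((⟨h, hD⟩ : D) * d))))⟩
  have huniq : ∀ a b : D, (∀ d : D, ω (incl hDM (a * d)) = ω (incl hDM (b * d))) → a = b := by
    intro a b h
    refine sub_eq_zero.1 (eq_zero_of_forall_apply_mul hfaith fun d => ?_)
    rw [sub_mul, map_sub, map_sub, h d, sub_self]
  choose e he using hex
  have hmul : ∀ a b : D, incl hDM (a * b) = incl hDM a * incl hDM b := fun _ _ => rfl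
  have hincl : ∀ d : D, e (incl hDM d) = d := fun d => huniq _ _ fun d' => by rw [← he, hmul]
  let E : M →ₗ[ℂ] D :=
    { toFun := e
      map_add' := fun x y => huniq _ _ fun d => by
        rw [← he, add_mul, add_mul, map_add, map_add, map_add, he, he]
      map_smul' := fun c x => huniq _ _ fun d => by
        have h1 : (c • x) * incl hDM d = c • (x * incl hDM d) :=
          Subtype.ext (smul_mul_assoc c (x : H →L[ℂ] H) (d : H →L[ℂ] H))
        have h2 : (c • e x) * d = c • (e x * d) :=
          Subtype.ext (smul_mul_assoc c (e x : H →L[ℂ] H) (d : H →L[ℂ] H))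
        rw [← he, h1, RingHom.id_apply, h2, map_smul, map_smul, map_smul, he] }
  have hpos : IsPositiveMap E := by
    intro x hx
    obtain ⟨h, hD, h0, hh⟩ := exists_density_of_nonneg hφp hDM hφn hφ1 hφf hφc x.2 hx
    have : e x = ⟨h, hD⟩ := huniq _ _ fun d => by
      rw [← he]
      exact (hφ (x * incl hDM d)).symm.trans
        ((hh d d.2).trans (hφ (incl hDM ((⟨h, hD⟩ : D) * d))))
    change 0 ≤ e x
    rw [this]
    exact h0
  have hpres : Preserves hDM ω E := fun x => by
    have h1 := he x 1
    have h2 : x * incl hDM 1 = x := mul_one x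
    rw [h2, mul_one] at h1
    exact h1.symm
  refine ⟨E, ⟨hincl 1, hpos, fun x => hincl _, fun d => ⟨incl hDM d, hincl d⟩, fun d x => ?_,
    fun d x => ?_, isNormalMap_of_preserves hω hDM hfaith hpos hpres⟩, hpres⟩
  -- ω(d x d') = ω(x d' d) = ω(E(x) d' d) = ω(d E(x) d'), centrality of d being used twice.
  · refine huniq _ _ fun d' => ?_
    change ω (incl hDM (e _ * d')) = ω (incl hDM (d * e x * d'))
    rw [← he, mul_assoc, hcen, mul_assoc, ← hmul, he, ← mul_assoc, hmul, ← hcen, ← hmul,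
      ← mul_assoc]
  · refine huniq _ _ fun d' => ?_
    change ω (incl hDM (e _ * d')) = ω (incl hDM (e x * d * d'))
    rw [← he, mul_assoc, ← hmul, he, mul_assoc]

theorem centralizes_of_isNormalCondExp {ω : M →ₗ[ℂ] ℂ} {hDM : D ≤ M}
    (htr : D.IsTracial (ω ∘ₗ incl hDM)) {E : M →ₗ[ℂ] D} (hE : IsNormalCondExp hDM E)
    (hp : Preserves hDM ω E) (d : D) (x : M) : ω (incl hDM d * x) = ω (x * incl hDM d) := by
  rw [← hp (incl hDM d * x), ← hp (x * incl hDM d), hE.map_mul_left, hE.map_mul_right]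
  exact htr.apply_mul_comm d (E x)

theorem IsNormalCondExp.eq_of_preserves {ω : M →ₗ[ℂ] ℂ} {hDM : D ≤ M}
    (hfaith : IsFaithfulMap (ω ∘ₗ incl hDM)) {E F : M →ₗ[ℂ] D} (hE : IsNormalCondExp hDM E)
    (hpE : Preserves hDM ω E) (hF : IsNormalCondExp hDM F) (hpF : Preserves hDM ω F) : E = F := by
  refine LinearMap.ext fun x => sub_eq_zero.1 (eq_zero_of_forall_apply_mul hfaith fun d => ?_)
  rw [sub_mul, map_sub, map_sub, ← hE.map_mul_right, ← hF.map_mul_right, hpE, hpF, sub_self]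

theorem Preserves.isFaithfulMap {ω : M →ₗ[ℂ] ℂ} {hDM : D ≤ M} {E : M →ₗ[ℂ] D}
    (hp : Preserves hDM ω E) (hω : IsFaithfulMap ω) : IsFaithfulMap E := fun x hx h =>
  hω x hx (by rw [← hp x, h, map_zero, map_zero])

end VonNeumannAlgebra

end ConditionalExpectation

theorem theorem3p4 {H : Type*} [NormedAddCommGroup H] [InnerProductSpace ℂ H] [CompleteSpace H]
    (M D : VonNeumannAlgebra H) (hDM : D ≤ M) (ω : M →ₗ[ℂ] ℂ) (hω : M.IsNormalState ω)
    (hfaith : IsFaithfulMap (ω ∘ₗ VonNeumannAlgebra.incl hDM))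
    (htr : D.IsTracial (ω ∘ₗ VonNeumannAlgebra.incl hDM)) :
    ((∀ (d : D) (x : M), ω (VonNeumannAlgebra.incl hDM d * x) = ω (x * VonNeumannAlgebra.incl hDM d)) ↔
      ∃ E : M →ₗ[ℂ] D,
        VonNeumannAlgebra.IsNormalCondExp hDM E ∧ VonNeumannAlgebra.Preserves hDM ω E) ∧
    (∀ E F : M →ₗ[ℂ] D,
      VonNeumannAlgebra.IsNormalCondExp hDM E → VonNeumannAlgebra.Preserves hDM ω E →
      VonNeumannAlgebra.IsNormalCondExp hDM F → VonNeumannAlgebra.Preserves hDM ω F → E = F) ∧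
    (IsFaithfulMap ω → ∀ E : M →ₗ[ℂ] D,
      VonNeumannAlgebra.IsNormalCondExp hDM E → VonNeumannAlgebra.Preserves hDM ω E →
      IsFaithfulMap E) :=
  ⟨⟨VonNeumannAlgebra.exists_isNormalCondExp_of_centralizes hω hDM hfaith,
      fun ⟨_, hE, hp⟩ => VonNeumannAlgebra.centralizes_of_isNormalCondExp htr hE hp⟩,
    fun _ _ hE hpE hF hpF => hE.eq_of_preserves hfaith hpE hF hpF,
    fun hf _ _ hp => hp.isFaithfulMap hf⟩
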